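/- Let $M$ be a compact $n$-dimensional smooth manifold (without boundary), let $p,l\ge 0$ be integers, and let $\omega=\{\omega(t)\}_{t\in\mathbb{R}^l}$ be a family of $p$-forms on $M$. Fix a finite family of smooth charts $\phi_i:U_i\to\mathbb{R}^n$ of $M$ and a smooth partition of unity $\{\lambda_i\}$ with $\operatorname{supp}\lambda_i\subset U_i$. For $k\ge 0$ let $C^k(M,\Lambda^p)$ be the Banach space of $p$-forms on $M$ of class $C^k$, with the norm $$\|\eta\|_{C^k(M)}:=\sum_i\ \sum_{|\alpha|\le k}\ \sup_{x\in\mathbb{R}^n}\bigl|\partial_x^\alpha\bigl(\phi_{i*}(\lambda_i\eta)\bigr)(x)\bigr|,$$ where $\phi_{i*}(\lambda_i\eta)$ is the vector of coefficients of $\lambda_i\eta$ in the chart $\phi_i$, extended by zero to $\mathbb{R}^n$. Then the following are equivalent. 1. $\omega$ is a smooth family: in all local coordinates $x_1,\dots,x_n$ of $M$, the coefficients of $\omega(t)$ are smooth ($C^\infty$) functions of $(t,x)$ jointly. 2. For every integer $k\ge 0$, each $\omega(t)$ belongs to $C^k(M,\Lambda^p)$, and the map $\mathbb{R}^l\to C^k(M,\Lambda^p)$,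 $t\mapsto\omega(t)$, is smooth ($C^\infty$ in the sense of Fréchet derivatives between normed spaces). -/

import Mathlib

open scoped Manifold ContDiff

noncomputable section

namespace FormFamily

/-! ### Partial derivatives of vector valued functions on `ℝⁿ` -/

section PartialDerivatives

variable {n : ℕ} {V : Type*} [NormedAddCommGroup V] [NormedSpace ℝ V]

/-- The partial derivative `∂f/∂xᵢ`. -/
def pderiv (i : Fin n) (f : EuclideanSpace ℝ (Fin n) → V) : EuclideanSpace ℝ (Fin n) → V :=
  fun y => fderiv ℝ f y (EuclideanSpace.single i (1 : ℝ))

/-- The mixed partial derivative given by a multi-index `α` along a list of directions: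
for the list `[i₁, …, iᵣ]` it is `∂_{i₁}^{α i₁} ⋯ ∂_{iᵣ}^{α iᵣ} f`. -/
def pderivList (α : Fin n → ℕ) (L : List (Fin n)) (f : EuclideanSpace ℝ (Fin n) → V) :
    EuclideanSpace ℝ (Fin n) → V :=
  L.foldr (fun i g => (pderiv i)^[α i] g) f

/-- `∂^α f = ∂₁^{α₁} ⋯ ∂ₙ^{αₙ} f`. -/
def mpderiv (α : Fin n → ℕ) (f : EuclideanSpace ℝ (Fin n) → V) : EuclideanSpace ℝ (Fin n) → V :=
  pderivList α (List.finRange n) f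

/-- The `C^k` norm `∑_{|α| ≤ k} sup_y |∂^α f(y)|`. -/
def ckNorm (k : ℕ) (f : EuclideanSpace ℝ (Fin n) → V) : ℝ :=
  ∑ j ∈ Finset.range (k + 1), ∑ α ∈ Finset.Nat.antidiagonalTuple n j,
    ⨆ y : EuclideanSpace ℝ (Fin n), ‖mpderiv α f y‖

lemma contDiff_pderiv {m : ℕ} (i : Fin n) {f : EuclideanSpace ℝ (Fin n) → V}
    (hf : ContDiff ℝ ((m + 1 : ℕ) : ℕ∞) f) : ContDiff ℝ (m : ℕ∞) (pderiv i f) := by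
  have h : ContDiff ℝ (m : ℕ∞) (fderiv ℝ f) := hf.fderiv_right (by norm_cast)
  exact h.clm_apply contDiff_const

lemma contDiff_pderiv_iterate (i : Fin n) (a m : ℕ) {f : EuclideanSpace ℝ (Fin n) → V}
    (hf : ContDiff ℝ ((m + a : ℕ) : ℕ∞) f) : ContDiff ℝ (m : ℕ∞) ((pderiv i)^[a] f) := by
  induction a generalizing f with
  | zero => simpa using hf
  | succ a ih =>
    rw [Function.iterate_succ_apply]
    exact ih (contDiff_pderiv i hf)

lemma contDiff_pderivList (α : Fin n → ℕ) (L : List (Fin n)) (m : ℕ)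
    {f : EuclideanSpace ℝ (Fin n) → V}
    (hf : ContDiff ℝ ((m + (L.map α).sum : ℕ) : ℕ∞) f) :
    ContDiff ℝ (m : ℕ∞) (pderivList α L f) := by
  induction L generalizing m with
  | nil => simpa [pderivList] using hf
  | cons i L ih =>
    refine contDiff_pderiv_iterate i (α i) m (ih (m + α i) ?_)
    simpa [add_assoc] using hf

lemma pderiv_add (i : Fin n) {f g : EuclideanSpace ℝ (Fin n) → V}
    (hf : Differentiable ℝ f) (hg : Differentiable ℝ g) :
    pderiv i (f + g) = pderiv i f + pderiv i g := by
  ext1 y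
  simp [pderiv, fderiv_add (hf y) (hg y)]

lemma pderiv_smul (i : Fin n) (c : ℝ) {f : EuclideanSpace ℝ (Fin n) → V}
    (hf : Differentiable ℝ f) : pderiv i (c • f) = c • pderiv i f := by
  ext1 y
  simp [pderiv, fderiv_const_smul (hf y)]

lemma pderiv_iterate_add (i : Fin n) (a : ℕ) {f g : EuclideanSpace ℝ (Fin n) → V}
    (hf : ContDiff ℝ (a : ℕ∞) f) (hg : ContDiff ℝ (a : ℕ∞) g) :
    (pderiv i)^[a] (f + g) = (pderiv i)^[a] f + (pderiv i)^[a] g := by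
  induction a generalizing f g with
  | zero => rfl
  | succ a ih =>
    simp only [Function.iterate_succ_apply]
    rw [pderiv_add i (hf.differentiable (by simp)) (hg.differentiable (by simp)),
      ih (contDiff_pderiv i hf) (contDiff_pderiv i hg)]

lemma pderiv_iterate_smul (i : Fin n) (a : ℕ) (c : ℝ) {f : EuclideanSpace ℝ (Fin n) → V}
    (hf : ContDiff ℝ (a : ℕ∞) f) :
    (pderiv i)^[a] (c • f) = c • (pderiv i)^[a] f := by
  induction a generalizing f with
  | zero => rfl
  | succ a ih =>
    simp only [Function.iterate_succ_apply]
    rw [pderiv_smul i c (hf.differentiable (by simp)), ih (contDiff_pderiv i hf)]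

lemma pderivList_add (α : Fin n → ℕ) (L : List (Fin n)) {f g : EuclideanSpace ℝ (Fin n) → V}
    (hf : ContDiff ℝ ((L.map α).sum : ℕ∞) f) (hg : ContDiff ℝ ((L.map α).sum : ℕ∞) g) :
    pderivList α L (f + g) = pderivList α L f + pderivList α L g := by
  induction L with
  | nil => rfl
  | cons i L ih =>
    have hle : (((L.map α).sum : ℕ∞) : WithTop ℕ∞) ≤ (((i :: L).map α).sum : ℕ∞) := by
      norm_cast; simp
    have hf' : ContDiff ℝ ((α i + (L.map α).sum : ℕ) : ℕ∞) f := by simpa using hf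
    have hg' : ContDiff ℝ ((α i + (L.map α).sum : ℕ) : ℕ∞) g := by simpa using hg
    change (pderiv i)^[α i] (pderivList α L (f + g)) = _
    rw [ih (hf.of_le hle) (hg.of_le hle), pderiv_iterate_add i (α i)
      (contDiff_pderivList α L (α i) hf') (contDiff_pderivList α L (α i) hg')]
    rfl

lemma pderivList_smul (α : Fin n → ℕ) (L : List (Fin n)) (c : ℝ)
    {f : EuclideanSpace ℝ (Fin n) → V} (hf : ContDiff ℝ ((L.map α).sum : ℕ∞) f) :
    pderivList α L (c • f) = c • pderivList α L f := by
  induction L with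
  | nil => rfl
  | cons i L ih =>
    have hle : (((L.map α).sum : ℕ∞) : WithTop ℕ∞) ≤ (((i :: L).map α).sum : ℕ∞) := by
      norm_cast; simp
    have hf' : ContDiff ℝ ((α i + (L.map α).sum : ℕ) : ℕ∞) f := by simpa using hf
    change (pderiv i)^[α i] (pderivList α L (c • f)) = _
    rw [ih (hf.of_le hle), pderiv_iterate_smul i (α i) c (contDiff_pderivList α L (α i) hf')]
    rfl

lemma hasCompactSupport_pderivList (α : Fin n → ℕ) (L : List (Fin n))
    {f : EuclideanSpace ℝ (Fin n) → V} (hf : HasCompactSupport f) :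
    HasCompactSupport (pderivList α L f) := by
  have key : ∀ (i : Fin n) (a : ℕ) (g : EuclideanSpace ℝ (Fin n) → V), HasCompactSupport g →
      HasCompactSupport ((pderiv i)^[a] g) := by
    intro i a
    induction a with
    | zero => exact fun g hg => hg
    | succ a ih =>
      intro g hg
      rw [Function.iterate_succ_apply]
      exact ih _ (hg.fderiv_apply (𝕜 := ℝ) _)
  induction L with
  | nil => exact hf
  | cons i L ih => exact key i (α i) _ ih

lemma sum_map_finRange (α : Fin n → ℕ) : ((List.finRange n).map α).sum = ∑ i, α i := by
  rw [Fin.sum_univ_def]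

lemma bddAbove_mpderiv {α : Fin n → ℕ} {f : EuclideanSpace ℝ (Fin n) → V}
    (hf : ContDiff ℝ ((∑ i, α i : ℕ) : ℕ∞) f) (hc : HasCompactSupport f) :
    BddAbove (Set.range fun y => ‖mpderiv α f y‖) := by
  have h0 : ContDiff ℝ ((0 : ℕ) : ℕ∞) (mpderiv α f) :=
    contDiff_pderivList α _ 0 (by rw [sum_map_finRange, zero_add]; exact hf)
  obtain ⟨C, hC⟩ := (hasCompactSupport_pderivList α (List.finRange n) hc).exists_bound_of_continuous
    h0.continuous
  exact ⟨C, by rintro _ ⟨y, rfl⟩; exact hC y⟩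

lemma mpderiv_add {α : Fin n → ℕ} {f g : EuclideanSpace ℝ (Fin n) → V}
    (hf : ContDiff ℝ ((∑ i, α i : ℕ) : ℕ∞) f) (hg : ContDiff ℝ ((∑ i, α i : ℕ) : ℕ∞) g) :
    mpderiv α (f + g) = mpderiv α f + mpderiv α g :=
  pderivList_add α _ (by rw [sum_map_finRange]; exact hf) (by rw [sum_map_finRange]; exact hg)

lemma mpderiv_smul {α : Fin n → ℕ} (c : ℝ) {f : EuclideanSpace ℝ (Fin n) → V}
    (hf : ContDiff ℝ ((∑ i, α i : ℕ) : ℕ∞) f) : mpderiv α (c • f) = c • mpderiv α f :=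
  pderivList_smul α _ c (by rw [sum_map_finRange]; exact hf)

lemma ckNorm_nonneg (k : ℕ) (f : EuclideanSpace ℝ (Fin n) → V) : 0 ≤ ckNorm k f :=
  Finset.sum_nonneg fun _ _ => Finset.sum_nonneg fun _ _ => Real.iSup_nonneg fun _ => norm_nonneg _

lemma contDiff_of_mem {k j : ℕ} (hj : j ∈ Finset.range (k + 1)) {α : Fin n → ℕ}
    (hα : α ∈ Finset.Nat.antidiagonalTuple n j) {f : EuclideanSpace ℝ (Fin n) → V}
    (hf : ContDiff ℝ (k : ℕ∞) f) : ContDiff ℝ ((∑ i, α i : ℕ) : ℕ∞) f := by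
  rw [Finset.Nat.mem_antidiagonalTuple] at hα
  refine hf.of_le ?_
  rw [hα]
  have := Finset.mem_range_succ_iff.1 hj
  exact_mod_cast this

lemma ckNorm_add_le (k : ℕ) {f g : EuclideanSpace ℝ (Fin n) → V}
    (hf : ContDiff ℝ (k : ℕ∞) f) (hg : ContDiff ℝ (k : ℕ∞) g)
    (hfc : HasCompactSupport f) (hgc : HasCompactSupport g) :
    ckNorm k (f + g) ≤ ckNorm k f + ckNorm k g := by
  simp only [ckNorm, ← Finset.sum_add_distrib]
  refine Finset.sum_le_sum fun j hj => Finset.sum_le_sum fun α hα => ?_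
  have hf' := contDiff_of_mem hj hα hf
  have hg' := contDiff_of_mem hj hα hg
  refine ciSup_le fun y => ?_
  rw [mpderiv_add hf' hg']
  exact (norm_add_le _ _).trans (add_le_add (le_ciSup (bddAbove_mpderiv hf' hfc) y)
    (le_ciSup (bddAbove_mpderiv hg' hgc) y))

lemma ckNorm_smul (k : ℕ) (c : ℝ) {f : EuclideanSpace ℝ (Fin n) → V}
    (hf : ContDiff ℝ (k : ℕ∞) f) : ckNorm k (c • f) = |c| * ckNorm k f := by
  simp only [ckNorm, Finset.mul_sum]
  refine Finset.sum_congr rfl fun j hj => Finset.sum_congr rfl fun α hα => ?_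
  rw [mpderiv_smul c (contDiff_of_mem hj hα hf), Real.mul_iSup_of_nonneg (abs_nonneg c)]
  simp [norm_smul]

lemma eq_zero_of_ckNorm_eq_zero (k : ℕ) {f : EuclideanSpace ℝ (Fin n) → V}
    (hf : ContDiff ℝ (k : ℕ∞) f) (hfc : HasCompactSupport f) (h : ckNorm k f = 0) : f = 0 := by
  have h0 : (0 : ℕ) ∈ Finset.range (k + 1) := by simp
  have hα : (0 : Fin n → ℕ) ∈ Finset.Nat.antidiagonalTuple n 0 := by
    simp [Finset.Nat.mem_antidiagonalTuple]
  have hnn : ∀ α : Fin n → ℕ, 0 ≤ ⨆ y : EuclideanSpace ℝ (Fin n), ‖mpderiv α f y‖ :=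
    fun α => Real.iSup_nonneg fun _ => norm_nonneg _
  have h1 := (Finset.sum_eq_zero_iff_of_nonneg
    (fun j _ => Finset.sum_nonneg fun α _ => hnn α)).1 h 0 h0
  have h2 := (Finset.sum_eq_zero_iff_of_nonneg (fun α _ => hnn α)).1 h1 0 hα
  have h3 : mpderiv (0 : Fin n → ℕ) f = f := by
    have : ∀ L : List (Fin n), pderivList 0 L f = f := by
      intro L
      induction L with
      | nil => rfl
      | cons i L ih => exact ih
    exact this _
  ext1 y
  have h4 := le_ciSup (bddAbove_mpderiv (contDiff_of_mem h0 hα hf) hfc) y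
  rw [h2, h3] at h4
  simpa using h4

end PartialDerivatives

/-! ### Differential forms in local coordinates -/

section Forms

variable {n p : ℕ} {M : Type*} [TopologicalSpace M] [ChartedSpace (EuclideanSpace ℝ (Fin n)) M]

variable (n p M) in
/-- A (not necessarily continuous) differential `p`-form on `M`: an alternating `p`-linear form on
every tangent space. -/
abbrev Form : Type _ := (x : M) → (TangentSpace (𝓡 n) x) [⋀^Fin p]→L[ℝ] ℝ

/-- The coordinate vector field `∂/∂xᵢ` of the chart `φ`, at the point of `M` with
coordinates `y`. -/
def coordVector (φ : OpenPartialHomeomorph M (EuclideanSpace ℝ (Fin n)))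
    (y : EuclideanSpace ℝ (Fin n)) (i : Fin n) : TangentSpace (𝓡 n) (φ.symm y) :=
  mfderiv (𝓡 n) (𝓡 n) φ.symm y (EuclideanSpace.single i (1 : ℝ))

/-- The vector of coefficients of the form `η` in the chart `φ`, as a function of the coordinates
`y`: if `η = ∑ η_{s₁ ⋯ s_p} dx_{s₁} ∧ ⋯ ∧ dx_{s_p}` (sum over `s₁ < ⋯ < s_p`), then the
component with index `s` is `η_{s₁ ⋯ s_p}`. Only meaningful for `y ∈ φ.target`. -/
def coeff (φ : OpenPartialHomeomorph M (EuclideanSpace ℝ (Fin n))) (η : Form n p M)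
    (y : EuclideanSpace ℝ (Fin n)) : EuclideanSpace ℝ (Fin p ↪o Fin n) :=
  WithLp.toLp 2 fun s => η (φ.symm y) fun a => coordVector φ y (s a)

/-- A family of `p`-forms with parameter `t ∈ ℝˡ` is smooth if in all local coordinates its
coefficients are smooth functions of `(t, x)` jointly. -/
def IsSmoothFamily {l : ℕ} (η : EuclideanSpace ℝ (Fin l) → Form n p M) : Prop :=
  ∀ φ ∈ IsManifold.maximalAtlas (𝓡 n) ∞ M,
    ContDiffOn ℝ ∞
      (fun q : EuclideanSpace ℝ (Fin l) × EuclideanSpace ℝ (Fin n) => coeff φ (η q.1) q.2)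
      (Set.univ ×ˢ φ.target)

/-- A form is of class `C^k` if in all local coordinates its coefficients are of class `C^k`. -/
def IsCk (k : ℕ) (η : Form n p M) : Prop :=
  ∀ φ ∈ IsManifold.maximalAtlas (𝓡 n) ∞ M, ContDiffOn ℝ (k : ℕ∞) (coeff φ η) φ.target

lemma coeff_add (φ : OpenPartialHomeomorph M (EuclideanSpace ℝ (Fin n))) (η θ : Form n p M) :
    coeff φ (η + θ) = coeff φ η + coeff φ θ := rfl

lemma coeff_smul (φ : OpenPartialHomeomorph M (EuclideanSpace ℝ (Fin n))) (c : ℝ)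
    (η : Form n p M) : coeff φ (c • η) = c • coeff φ η := rfl

variable (n M) in
/-- A finite family of charts of `M`, with a smooth partition of unity such that the support of
each member lies in the domain of the corresponding chart. -/
structure ChartPartition (ι : Type*) where
  /-- The charts. -/
  chart : ι → OpenPartialHomeomorph M (EuclideanSpace ℝ (Fin n))
  chart_mem : ∀ i, chart i ∈ IsManifold.maximalAtlas (𝓡 n) ∞ M
  /-- The partition of unity. -/
  pou : SmoothPartitionOfUnity ι (𝓡 n) M
  subordinate : ∀ i, tsupport (pou i) ⊆ (chart i).source

variable {ι : Type*}

open scoped Classical in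
/-- The coefficients of the form `λᵢ η` in the `i`-th chart, extended by zero to a function
on `ℝⁿ`. -/
def ChartPartition.localCoeff (D : ChartPartition n M ι) (i : ι) (η : Form n p M)
    (y : EuclideanSpace ℝ (Fin n)) : EuclideanSpace ℝ (Fin p ↪o Fin n) :=
  if y ∈ (D.chart i).target then
    coeff (D.chart i) (fun x => D.pou i x • η x) y
  else 0

lemma mdifferentiable_of_mem {φ : OpenPartialHomeomorph M (EuclideanSpace ℝ (Fin n))}
    [IsManifold (𝓡 n) ∞ M] (hφ : φ ∈ IsManifold.maximalAtlas (𝓡 n) ∞ M) :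
    φ.MDifferentiable (𝓡 n) (𝓡 n) :=
  ⟨(contMDiffOn_of_mem_maximalAtlas hφ).mdifferentiableOn (by simp),
    (contMDiffOn_symm_of_mem_maximalAtlas hφ).mdifferentiableOn (by simp)⟩

/-- A form vanishes at a point if its coefficients do. -/
lemma eq_zero_of_coeff_eq_zero [IsManifold (𝓡 n) ∞ M]
    {φ : OpenPartialHomeomorph M (EuclideanSpace ℝ (Fin n))}
    (hφ : φ ∈ IsManifold.maximalAtlas (𝓡 n) ∞ M) {y : EuclideanSpace ℝ (Fin n)}
    (hy : y ∈ φ.target) {η : Form n p M} (h : coeff φ η y = 0) : η (φ.symm y) = 0 := by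
  let e : EuclideanSpace ℝ (Fin n) ≃ₗ[ℝ] TangentSpace (𝓡 n) (φ.symm y) :=
    ((mdifferentiable_of_mem hφ).symm.mfderiv (x := y) hy).toLinearEquiv
  let b : Module.Basis (Fin n) ℝ (TangentSpace (𝓡 n) (φ.symm y)) :=
    (EuclideanSpace.basisFun (Fin n) ℝ).toBasis.map e
  have hb : ∀ i, b i = coordVector φ y i := by
    intro i
    simp only [b, Module.Basis.map_apply, OrthonormalBasis.coe_toBasis,
      EuclideanSpace.basisFun_apply]
    rfl
  have hmono : ∀ s : Fin p ↪o Fin n, η (φ.symm y) (fun a => b (s a)) = 0 := by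
    intro s
    simp only [hb]
    exact congrFun (congrArg WithLp.ofLp h) s
  have h0 : (η (φ.symm y)).toAlternatingMap = 0 := by
    refine Module.Basis.ext_alternating b fun v hv => ?_
    have hs : StrictMono (v ∘ Tuple.sort v) :=
      (Tuple.monotone_sort v).strictMono_of_injective (hv.comp (Equiv.injective _))
    have h1 := hmono (OrderEmbedding.ofStrictMono _ hs)
    have h2 := (η (φ.symm y)).toAlternatingMap.map_perm (fun a => b (v a)) (Tuple.sort v)
    have h3 : (η (φ.symm y)).toAlternatingMap ((fun a => b (v a)) ∘ Tuple.sort v) = 0 := h1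
    rw [h3] at h2
    rw [AlternatingMap.zero_apply]
    exact (smul_eq_zero_iff_eq _).1 h2.symm
  ext v
  exact congrArg (fun g => g v) h0

namespace ChartPartition

variable (D : ChartPartition n M ι)

lemma localCoeff_apply_of_mem (i : ι) (η : Form n p M) {y : EuclideanSpace ℝ (Fin n)}
    (hy : y ∈ (D.chart i).target) :
    D.localCoeff i η y = D.pou i ((D.chart i).symm y) • coeff (D.chart i) η y := by
  rw [localCoeff, if_pos hy]
  rfl

lemma localCoeff_add (i : ι) (η θ : Form n p M) :
    D.localCoeff i (η + θ) = D.localCoeff i η + D.localCoeff i θ := by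
  ext1 y
  by_cases hy : y ∈ (D.chart i).target
  · simp [D.localCoeff_apply_of_mem i _ hy, coeff_add]
  · simp [localCoeff, hy]

lemma localCoeff_smul (i : ι) (c : ℝ) (η : Form n p M) :
    D.localCoeff i (c • η) = c • D.localCoeff i η := by
  ext1 y
  by_cases hy : y ∈ (D.chart i).target
  · simp [D.localCoeff_apply_of_mem i _ hy, coeff_smul, smul_comm c]
  · simp [localCoeff, hy]

lemma localCoeff_eq_zero (i : ι) (η : Form n p M) {y : EuclideanSpace ℝ (Fin n)}
    (hy : y ∉ D.chart i '' tsupport (D.pou i)) : D.localCoeff i η y = 0 := by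
  by_cases hy' : y ∈ (D.chart i).target
  · have h : (D.chart i).symm y ∉ tsupport (D.pou i) :=
      fun h => hy ⟨_, h, (D.chart i).right_inv hy'⟩
    rw [D.localCoeff_apply_of_mem i η hy', image_eq_zero_of_notMem_tsupport h, zero_smul]
  · simp [localCoeff, hy']

lemma eq_zero_of_localCoeff_eq_zero [IsManifold (𝓡 n) ∞ M] {η : Form n p M}
    (h : ∀ i, D.localCoeff i η = 0) : η = 0 := by
  funext x
  obtain ⟨i, hi⟩ : ∃ i, D.pou i x ≠ 0 := by
    by_contra! hx
    have := D.pou.sum_eq_one (Set.mem_univ x)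
    simp [hx] at this
  have hx : x ∈ (D.chart i).source := D.subordinate i (subset_tsupport _ hi)
  have hy := (D.chart i).map_source hx
  have h1 := congrFun (h i) (D.chart i x)
  rw [D.localCoeff_apply_of_mem i η hy, (D.chart i).left_inv hx, Pi.zero_apply,
    smul_eq_zero_iff_right hi] at h1
  have h2 := eq_zero_of_coeff_eq_zero (D.chart_mem i) hy h1
  rwa [(D.chart i).left_inv hx] at h2

variable [CompactSpace M]

/-- The compact set, inside the image of the `i`-th chart, that carries the local
coefficients. -/
lemma isCompact_image (i : ι) : IsCompact (D.chart i '' tsupport (D.pou i)) :=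
  (isClosed_tsupport _).isCompact.image_of_continuousOn
    ((D.chart i).continuousOn.mono (D.subordinate i))

lemma hasCompactSupport_localCoeff (i : ι) (η : Form n p M) :
    HasCompactSupport (D.localCoeff i η) :=
  HasCompactSupport.intro (D.isCompact_image i) fun _ hy => D.localCoeff_eq_zero i η hy

lemma contDiff_localCoeff [IsManifold (𝓡 n) ∞ M] (i : ι) {k : ℕ} {η : Form n p M}
    (hη : IsCk k η) : ContDiff ℝ (k : ℕ∞) (D.localCoeff i η) := by
  rw [contDiff_iff_contDiffAt]
  intro y
  by_cases hy : y ∈ (D.chart i).target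
  · have hn : (D.chart i).target ∈ nhds y := (D.chart i).open_target.mem_nhds hy
    have h1 : ContDiffOn ℝ (k : ℕ∞) (fun y => D.pou i ((D.chart i).symm y))
        (D.chart i).target := by
      have h : ContMDiffOn (𝓡 n) 𝓘(ℝ, ℝ) ∞ (fun y => D.pou i ((D.chart i).symm y))
          (D.chart i).target :=
        (D.pou i).contMDiff.comp_contMDiffOn
          (contMDiffOn_symm_of_mem_maximalAtlas (D.chart_mem i))
      exact h.contDiffOn.of_le (by exact_mod_cast le_top)
    have h2 := (h1.smul (hη _ (D.chart_mem i))).contDiffAt hn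
    refine h2.congr_of_eventuallyEq ?_
    filter_upwards [hn] with z hz
    exact D.localCoeff_apply_of_mem i η hz
  · have hn : (D.chart i '' tsupport (D.pou i))ᶜ ∈ nhds y := by
      refine (D.isCompact_image i).isClosed.isOpen_compl.mem_nhds ?_
      rintro ⟨x, hx, rfl⟩
      exact hy ((D.chart i).map_source (D.subordinate i hx))
    refine (contDiffAt_const (c := (0 : EuclideanSpace ℝ (Fin p ↪o Fin n)))).congr_of_eventuallyEq ?_
    filter_upwards [hn] with z hz
    exact D.localCoeff_eq_zero i η hz

end ChartPartition

variable (n p M) in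
/-- The vector space of `p`-forms of class `C^k` on `M`. -/
def ckSubmodule (k : ℕ) : Submodule ℝ (Form n p M) where
  carrier := {η | IsCk k η}
  add_mem' := fun ha hb φ hφ => (ha φ hφ).add (hb φ hφ)
  zero_mem' := fun _ _ => contDiffOn_const (c := 0)
  smul_mem' := fun c _ ha φ hφ => (ha φ hφ).const_smul c

variable (p) in
/-- The space `C^k(M, Λ^p)` of `p`-forms of class `C^k` on `M`, with the norm that is defined
through the charts and the partition of unity `D`. -/
def CkForms (_D : ChartPartition n M ι) (k : ℕ) : Type _ := ckSubmodule n p M k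

namespace CkForms

variable (D : ChartPartition n M ι) (k : ℕ)

instance : AddCommGroup (CkForms p D k) := inferInstanceAs (AddCommGroup (ckSubmodule n p M k))

instance : Module ℝ (CkForms p D k) := inferInstanceAs (Module ℝ (ckSubmodule n p M k))

variable {D k} in
/-- A form of class `C^k` as an element of the space `C^k(M, Λ^p)`. -/
def mk (η : Form n p M) (hη : IsCk k η) : CkForms p D k := ⟨η, hη⟩

variable {D k} in
/-- The form underlying an element of `C^k(M, Λ^p)`. -/
def form (η : CkForms p D k) : Form n p M := η.1

lemma isCk (η : CkForms p D k) : IsCk k η.form := η.2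

variable [Fintype ι]

/-- `‖η‖ = ∑ᵢ ‖φᵢ_* (λᵢ η)‖_{C^k}`. -/
instance : Norm (CkForms p D k) := ⟨fun η => ∑ i, ckNorm k (D.localCoeff i η.form)⟩

lemma norm_def (η : CkForms p D k) : ‖η‖ = ∑ i, ckNorm k (D.localCoeff i η.form) := rfl

variable [CompactSpace M] [IsManifold (𝓡 n) ∞ M]

lemma normedSpaceCore : NormedSpace.Core ℝ (CkForms p D k) where
  norm_nonneg η := Finset.sum_nonneg fun i _ => ckNorm_nonneg k _
  norm_smul c η := by
    simp only [norm_def, Finset.mul_sum, Real.norm_eq_abs]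
    refine Finset.sum_congr rfl fun i _ => ?_
    rw [← ckNorm_smul k c (D.contDiff_localCoeff i η.isCk), ← D.localCoeff_smul]
    rfl
  norm_triangle η θ := by
    simp only [norm_def, ← Finset.sum_add_distrib]
    refine Finset.sum_le_sum fun i _ => ?_
    refine le_trans (le_of_eq ?_) (ckNorm_add_le k (D.contDiff_localCoeff i η.isCk)
      (D.contDiff_localCoeff i θ.isCk) (D.hasCompactSupport_localCoeff i η.form)
      (D.hasCompactSupport_localCoeff i θ.form))
    rw [← D.localCoeff_add]
    rfl
  norm_eq_zero_iff η := by
    constructor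
    · intro h
      rw [norm_def, Finset.sum_eq_zero_iff_of_nonneg fun i _ => ckNorm_nonneg k _] at h
      refine Subtype.ext (D.eq_zero_of_localCoeff_eq_zero fun i => ?_)
      exact eq_zero_of_ckNorm_eq_zero k (D.contDiff_localCoeff i η.isCk)
        (D.hasCompactSupport_localCoeff i η.form) (h i (Finset.mem_univ i))
    · rintro rfl
      rw [norm_def]
      refine Finset.sum_eq_zero fun i _ => ?_
      have h : D.localCoeff i (0 : CkForms p D k).form =
          (0 : ℝ) • D.localCoeff i (0 : Form n p M) := by
        rw [← D.localCoeff_smul, zero_smul]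
        rfl
      have h0 : IsCk k (0 : Form n p M) := (0 : CkForms p D k).isCk
      rw [h, ckNorm_smul k 0 (D.contDiff_localCoeff i h0)]
      simp

instance : NormedAddCommGroup (CkForms p D k) := .ofCore (normedSpaceCore D k)

instance : NormedSpace ℝ (CkForms p D k) := .ofCore (normedSpaceCore D k)

end CkForms
end Forms
end FormFamily
end

noncomputable section

namespace FormFamily

/-! ### Commuting partial derivatives and pointwise bounds by the `C^k` norm. -/

section PartialDerivatives

variable {n : ℕ} {V : Type*} [NormedAddCommGroup V] [NormedSpace ℝ V]

/-! Everything is read off from the local coefficients `G_i(t, y)` of `λ_i ω(t)`, which vanish for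
`y` outside a fixed compact set.

If the family is smooth, each `G_i` is jointly smooth. By compactness, the first order Taylor
remainder in `t` of every `∂_y^α G_i` is `o(t - t₀)` uniformly in `y` (`isLittleO_ckNorm_taylor`).
So the map into `C^k` is differentiable, with derivative `v ↦ ∂_v ω(t)`. This is again a smooth
family for each `v`, and induction on the order gives `IsSmoothFamily.contDiff_mk`.

Conversely, for `|α| ≤ k` the functional `η ↦ ∂^α(λ_i η)(y)` is linear on `C^k` with bound `1`,
uniformly in `y`. It therefore commutes with derivatives in `t`, while a derivative in `y` only
raises `α`. Induction on `m` shows that `∂^α G_i` is jointly `C^m` when `|α| + m ≤ k`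
(`CkForms.contDiff_mpderiv_localCoeff`). Taking `α = 0` and `k = m` for all `m` makes `G_i` smooth;
dividing by `λ_i` where it is nonzero and changing coordinates
(`contDiffAt_coeff_of_contDiffAt_coeff`) yields smooth coefficients in every chart. -/

lemma pderiv_comm (i j : Fin n) {f : EuclideanSpace ℝ (Fin n) → V} (hf : ContDiff ℝ 2 f) :
    pderiv i (pderiv j f) = pderiv j (pderiv i f) := by
  have h : ∀ (a b : Fin n) (y : EuclideanSpace ℝ (Fin n)), pderiv a (pderiv b f) y =
      fderiv ℝ (fderiv ℝ f) y (EuclideanSpace.single a 1) (EuclideanSpace.single b 1) := by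
    intro a b y
    have hd : DifferentiableAt ℝ (fderiv ℝ f) y :=
      (hf.fderiv_right (m := 1) (by norm_num)).differentiable (by simp) y
    change fderiv ℝ (fun z => fderiv ℝ f z (EuclideanSpace.single b 1)) y _ = _
    rw [fderiv_clm_apply hd (differentiableAt_const _)]
    simp
  ext1 y
  rw [h, h]
  exact (hf.contDiffAt.isSymmSndFDerivAt (by simp)) _ _

lemma pderiv_iterate_comm (i j : Fin n) (a : ℕ) {f : EuclideanSpace ℝ (Fin n) → V}
    (hf : ContDiff ℝ ((a + 1 : ℕ) : ℕ∞) f) :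
    pderiv j ((pderiv i)^[a] f) = (pderiv i)^[a] (pderiv j f) := by
  induction a generalizing f with
  | zero => rfl
  | succ a ih =>
    rw [Function.iterate_succ_apply, Function.iterate_succ_apply, ih (contDiff_pderiv i hf),
      pderiv_comm j i (hf.of_le ?_)]
    exact WithTop.coe_le_coe.2 (show ((2 : ℕ) : ℕ∞) ≤ ((a + 1 + 1 : ℕ) : ℕ∞) by norm_cast; omega)

lemma pderivList_congr {α β : Fin n → ℕ} {L : List (Fin n)} (h : ∀ i ∈ L, α i = β i)
    (f : EuclideanSpace ℝ (Fin n) → V) : pderivList α L f = pderivList β L f := by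
  induction L with
  | nil => rfl
  | cons i L ih =>
    change (pderiv i)^[α i] (pderivList α L f) = (pderiv i)^[β i] (pderivList β L f)
    rw [h i (by simp), ih fun k hk => h k (by simp [hk])]

/-- The derivatives in `∂^α` are taken in a fixed order, so a new `∂_j` has to be moved inwards to
its own slot. As `L` has no repetitions, that slot occurs exactly once. -/
lemma pderiv_pderivList (α : Fin n → ℕ) (j : Fin n) {L : List (Fin n)} (hL : L.Nodup) (hj : j ∈ L)
    {f : EuclideanSpace ℝ (Fin n) → V} (hf : ContDiff ℝ (((L.map α).sum + 1 : ℕ) : ℕ∞) f) :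
    pderiv j (pderivList α L f) = pderivList (α + Pi.single j 1) L f := by
  induction L with
  | nil => simp at hj
  | cons i L ih =>
    change pderiv j ((pderiv i)^[α i] (pderivList α L f)) =
      (pderiv i)^[(α + Pi.single j 1 : Fin n → ℕ) i] (pderivList (α + Pi.single j 1) L f)
    rw [List.nodup_cons] at hL
    by_cases hij : i = j
    · subst hij
      -- The direction `i` does not occur in the tail, so raising its exponent changes nothing
      -- there.
      rw [← pderivList_congr (α := α) (β := α + Pi.single i 1)]
      · simp [← Function.iterate_succ_apply']
      · intro k hk
        have : k ≠ i := fun h => hL.1 (h ▸ hk)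
        simp [this]
    · have hf' : ContDiff ℝ ((α i + 1 + (L.map α).sum : ℕ) : ℕ∞) f := by
        refine hf.of_le ?_
        norm_cast
        simp
        omega
      rw [pderiv_iterate_comm i j (α i) (contDiff_pderivList α L _ hf'),
        ih hL.2 (by simpa [Ne.symm hij] using hj) (hf.of_le (by norm_cast; simp))]
      simp [hij]

lemma pderiv_mpderiv (α : Fin n → ℕ) (j : Fin n) {f : EuclideanSpace ℝ (Fin n) → V}
    (hf : ContDiff ℝ ((∑ i, α i + 1 : ℕ) : ℕ∞) f) :
    pderiv j (mpderiv α f) = mpderiv (α + Pi.single j 1) f :=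
  pderiv_pderivList α j (List.nodup_finRange n) (List.mem_finRange j)
    (by rw [sum_map_finRange]; exact hf)

lemma mpderiv_sub {α : Fin n → ℕ} {f g : EuclideanSpace ℝ (Fin n) → V}
    (hf : ContDiff ℝ ((∑ i, α i : ℕ) : ℕ∞) f) (hg : ContDiff ℝ ((∑ i, α i : ℕ) : ℕ∞) g) :
    mpderiv α (f - g) = mpderiv α f - mpderiv α g := by
  have hg' : ContDiff ℝ ((∑ i, α i : ℕ) : ℕ∞) ((-1 : ℝ) • g) := hg.const_smul (-1 : ℝ)
  rw [sub_eq_add_neg, ← neg_one_smul ℝ g, mpderiv_add hf hg', mpderiv_smul _ hg, neg_one_smul,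
    sub_eq_add_neg]

lemma mpderiv_zero (f : EuclideanSpace ℝ (Fin n) → V) : mpderiv 0 f = f := by
  have : ∀ L : List (Fin n), pderivList 0 L f = f := fun L => by
    induction L with
    | nil => rfl
    | cons i L ih => exact ih
  exact this _

lemma contDiff_mpderiv (α : Fin n → ℕ) (m : ℕ) {f : EuclideanSpace ℝ (Fin n) → V}
    (hf : ContDiff ℝ ((m + ∑ i, α i : ℕ) : ℕ∞) f) : ContDiff ℝ (m : ℕ∞) (mpderiv α f) :=
  contDiff_pderivList α _ m (by rw [sum_map_finRange]; exact hf)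

/-- The supremum is one term of a sum of nonnegative terms. Compact support is needed because a real
supremum over an unbounded set is `0` by convention. -/
lemma norm_mpderiv_le_ckNorm {k : ℕ} {α : Fin n → ℕ} (hα : ∑ i, α i ≤ k)
    {f : EuclideanSpace ℝ (Fin n) → V} (hf : ContDiff ℝ (k : ℕ∞) f) (hc : HasCompactSupport f)
    (y : EuclideanSpace ℝ (Fin n)) : ‖mpderiv α f y‖ ≤ ckNorm k f := by
  have hnn : ∀ β : Fin n → ℕ, 0 ≤ ⨆ y : EuclideanSpace ℝ (Fin n), ‖mpderiv β f y‖ :=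
    fun β => Real.iSup_nonneg fun _ => norm_nonneg _
  refine (le_ciSup (bddAbove_mpderiv (hf.of_le (by exact_mod_cast hα)) hc) y).trans ?_
  refine (Finset.single_le_sum (f := fun β => ⨆ y, ‖mpderiv β f y‖) (fun β _ => hnn β)
    (Finset.Nat.mem_antidiagonalTuple.2 rfl : α ∈ _)).trans ?_
  exact Finset.single_le_sum
    (f := fun j => ∑ β ∈ Finset.Nat.antidiagonalTuple n j, ⨆ y, ‖mpderiv β f y‖)
    (fun j _ => Finset.sum_nonneg fun β _ => hnn β) (Finset.mem_range_succ_iff.2 hα)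

end PartialDerivatives

/-! ### Functions depending smoothly on a parameter, and uniform Taylor expansion. -/

section Parameters

variable {n : ℕ} {V T : Type*} [NormedAddCommGroup V] [NormedSpace ℝ V]
  [NormedAddCommGroup T] [NormedSpace ℝ T]

lemma hasFDerivAt_slice_left {E : Type*} [NormedAddCommGroup E] [NormedSpace ℝ E]
    {G : T × E → V} {t : T} {y : E} (hG : DifferentiableAt ℝ G (t, y)) :
    HasFDerivAt (fun t => G (t, y)) ((fderiv ℝ G (t, y)).comp (.inl ℝ T E)) t :=
  hG.hasFDerivAt.comp t (hasFDerivAt_prodMk_left t y)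

lemma hasFDerivAt_slice_right {E : Type*} [NormedAddCommGroup E] [NormedSpace ℝ E]
    {G : T × E → V} (hG : Differentiable ℝ G) (t : T) (y : E) :
    HasFDerivAt (fun y => G (t, y)) ((fderiv ℝ G (t, y)).comp (.inr ℝ T E)) y :=
  (hG (t, y)).hasFDerivAt.comp y (hasFDerivAt_prodMk_right t y)

variable (T) in
/-- An operator on functions of `y` preserves smooth dependence on a parameter, commutes with
derivatives in the parameter, and does not enlarge supports. -/
def IsParametric (op : (EuclideanSpace ℝ (Fin n) → V) → EuclideanSpace ℝ (Fin n) → V) : Prop :=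
  ∀ G : T × EuclideanSpace ℝ (Fin n) → V, ContDiff ℝ ∞ G →
    ∃ H : T × EuclideanSpace ℝ (Fin n) → V, ContDiff ℝ ∞ H ∧
      (∀ t, op (fun y => G (t, y)) = fun y => H (t, y)) ∧
      (∀ t v, op (fun y => fderiv ℝ G (t, y) (v, 0)) = fun y => fderiv ℝ H (t, y) (v, 0)) ∧
      ∀ K : Set (EuclideanSpace ℝ (Fin n)), IsClosed K → (∀ t, ∀ y ∉ K, G (t, y) = 0) →
        ∀ t, ∀ y ∉ K, H (t, y) = 0

lemma isParametric_id :
    IsParametric (n := n) (V := V) T fun f => f := fun G hG =>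
  ⟨G, hG, fun _ => rfl, fun _ _ => rfl, fun _ _ h => h⟩

lemma IsParametric.comp {op₁ op₂ : (EuclideanSpace ℝ (Fin n) → V) → EuclideanSpace ℝ (Fin n) → V}
    (h₁ : IsParametric T op₁) (h₂ : IsParametric T op₂) :
    IsParametric T fun f => op₁ (op₂ f) := by
  intro G hG
  obtain ⟨H₂, hH₂, e₂, d₂, s₂⟩ := h₂ G hG
  obtain ⟨H₁, hH₁, e₁, d₁, s₁⟩ := h₁ H₂ hH₂
  exact ⟨H₁, hH₁, fun t => by simp only [e₂, e₁],
    fun t v => by simp only [d₂, d₁],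
    fun K hK h => s₁ K hK (s₂ K hK h)⟩

/-- The witness is the derivative of `G` in the direction `(0, e_i)`; commutation with parameter
derivatives is symmetry of the second derivative. -/
lemma isParametric_pderiv (i : Fin n) : IsParametric (V := V) T (pderiv i) := by
  intro G hG
  set e : T × EuclideanSpace ℝ (Fin n) := (0, EuclideanSpace.single i 1) with he
  have hd : Differentiable ℝ G := hG.differentiable (by simp)
  have hG' : ContDiff ℝ ∞ (fderiv ℝ G) := hG.fderiv_right (by simp)
  have hd' : Differentiable ℝ (fderiv ℝ G) := hG'.differentiable (by simp)
  have hslice : ∀ {F : T × EuclideanSpace ℝ (Fin n) → V} (_ : Differentiable ℝ F) (t : T),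
      pderiv i (fun y => F (t, y)) = fun y => fderiv ℝ F (t, y) e := by
    intro F hF t
    ext1 y
    rw [pderiv, (hasFDerivAt_slice_right hF t y).fderiv]
    simp [he]
  have happ : ∀ (w u : T × EuclideanSpace ℝ (Fin n)) (q : T × EuclideanSpace ℝ (Fin n)),
      fderiv ℝ (fun q => fderiv ℝ G q w) q u = fderiv ℝ (fderiv ℝ G) q u w := by
    intro w u q
    rw [fderiv_clm_apply (hd' q) (differentiableAt_const _)]
    simp
  refine ⟨fun q => fderiv ℝ G q e, hG'.clm_apply contDiff_const, hslice hd, fun t v => ?_, ?_⟩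
  · rw [hslice (F := fun q => fderiv ℝ G q (v, 0)) (hd'.clm_apply (differentiable_const _)) t]
    ext1 y
    rw [happ, happ]
    exact ((hG.of_le (WithTop.coe_le_coe.2 le_top)).contDiffAt.isSymmSndFDerivAt (n := 2)
      (by simp)) _ _
  · intro K hK h t y hy
    -- The complement of the closed set `K` is open, so `G` vanishes near `(t, y)` and its
    -- derivative is zero there.
    have hz : (fun q => G q) =ᶠ[nhds (t, y)] fun _ => 0 := by
      have : (Set.univ ×ˢ Kᶜ : Set (T × EuclideanSpace ℝ (Fin n))) ∈ nhds (t, y) :=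
        (isOpen_univ.prod hK.isOpen_compl).mem_nhds ⟨trivial, hy⟩
      filter_upwards [this] with q hq using h q.1 q.2 hq.2
    change fderiv ℝ G (t, y) e = 0
    rw [hz.fderiv_eq]
    simp

lemma isParametric_mpderiv (α : Fin n → ℕ) : IsParametric (V := V) T (mpderiv α) := by
  have hit : ∀ (i : Fin n) (a : ℕ), IsParametric (V := V) T (pderiv i)^[a] := by
    intro i a
    induction a with
    | zero => exact isParametric_id
    | succ a ih =>
      rw [Function.iterate_succ]
      exact ih.comp (isParametric_pderiv i)
  have : ∀ L : List (Fin n), IsParametric (V := V) T (pderivList α L) := by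
    intro L
    induction L with
    | nil => exact isParametric_id
    | cons i L ih => exact (hit i (α i)).comp ih
  exact this _

/-- The first order Taylor expansion in a parameter is uniform in a compactly supported
variable. -/
lemma isLittleO_iSup_norm_taylor {E : Type*} [NormedAddCommGroup E] [NormedSpace ℝ E]
    {H : T × E → V} (hH : ContDiff ℝ 1 H) {K : Set E} (hK : IsCompact K)
    (hz : ∀ t, ∀ y ∉ K, H (t, y) = 0) (t₀ : T) :
    (fun t => ⨆ y, ‖H (t, y) - H (t₀, y) - fderiv ℝ H (t₀, y) (t - t₀, 0)‖)
      =o[nhds t₀] fun t => t - t₀ := by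
  have hd : Differentiable ℝ H := hH.differentiable (by simp)
  have hc : Continuous (fderiv ℝ H) := hH.continuous_fderiv (by simp)
  rw [Asymptotics.isLittleO_iff]
  intro ε hε
  -- Compactness of `K` turns joint continuity of the derivative into closeness uniform in `y`.
  have hev : ∀ᶠ t in nhds t₀, ∀ y ∈ K, ‖fderiv ℝ H (t, y) - fderiv ℝ H (t₀, y)‖ < ε := by
    refine hK.eventually_forall_of_forall_eventually fun y _ => ?_
    have hcont : Continuous fun z : T × E => ‖fderiv ℝ H z - fderiv ℝ H (t₀, z.2)‖ := by fun_prop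
    exact hcont.continuousAt.eventually_lt continuousAt_const (by simpa using hε)
  obtain ⟨r, hr, hball⟩ := Metric.eventually_nhds_iff_ball.1 hev
  filter_upwards [Metric.ball_mem_nhds t₀ hr] with t ht
  rw [Real.norm_of_nonneg (Real.iSup_nonneg fun _ => norm_nonneg _)]
  refine ciSup_le fun y => ?_
  by_cases hy : y ∈ K
  -- Mean value inequality in `t` for `H(·, y)` minus its linear part at `t₀`.
  · refine (convex_ball t₀ r).norm_image_sub_le_of_norm_hasFDerivWithin_le'
      (f := fun t => H (t, y)) (φ := (fderiv ℝ H (t₀, y)).comp (.inl ℝ T E))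
      (fun s _ => (hasFDerivAt_slice_left (hd (s, y))).hasFDerivWithinAt) (fun s hs => ?_)
      (Metric.mem_ball_self hr) ht
    rw [← ContinuousLinearMap.sub_comp]
    refine (ContinuousLinearMap.opNorm_comp_le _ _).trans ?_
    refine (mul_le_mul (hball s hs y hy).le (ContinuousLinearMap.norm_inl_le_one ℝ T E)
      (norm_nonneg _) hε.le).trans (mul_one ε).le
  -- Off `K` the slice `t ↦ H(t, y)` is identically zero, hence so is its derivative.
  · have h0 : fderiv ℝ H (t₀, y) (t - t₀, 0) = 0 := by
      have h1 := hasFDerivAt_slice_left (hd (t₀, y))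
      simp only [hz _ y hy] at h1
      have h2 := congrArg (fun A => A (t - t₀)) (h1.unique (hasFDerivAt_const 0 t₀))
      simpa using h2
    rw [hz _ y hy, hz _ y hy, h0]
    simp only [sub_zero, norm_zero]
    positivity

/-- If `G` depends smoothly on a parameter then the Taylor remainder is small in `C^k`. -/
lemma isLittleO_ckNorm_taylor {G : T × EuclideanSpace ℝ (Fin n) → V} (hG : ContDiff ℝ ∞ G)
    {K : Set (EuclideanSpace ℝ (Fin n))} (hK : IsCompact K)
    (hz : ∀ t, ∀ y ∉ K, G (t, y) = 0) (k : ℕ) (t₀ : T) :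
    (fun t => ckNorm k (V := V) fun y => G (t, y) - G (t₀, y) - fderiv ℝ G (t₀, y) (t - t₀, 0))
      =o[nhds t₀] fun t => t - t₀ := by
  unfold ckNorm
  refine Asymptotics.IsLittleO.fun_sum fun j _ => Asymptotics.IsLittleO.fun_sum fun α _ => ?_
  obtain ⟨H, hH, he, hdv, hs⟩ := isParametric_mpderiv (V := V) (T := T) α G hG
  refine (isLittleO_iSup_norm_taylor (hH.of_le (by exact_mod_cast le_top)) hK
    (hs K hK.isClosed hz) t₀).congr_left fun t => ?_
  have hsl : ∀ (m : ℕ) (t : T), ContDiff ℝ (m : ℕ∞) fun y => G (t, y) := fun m t =>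
    (hG.comp (contDiff_prodMk_right t)).of_le (by exact_mod_cast le_top)
  have hsl' : ∀ (m : ℕ) (t v : T), ContDiff ℝ (m : ℕ∞) fun y => fderiv ℝ G (t, y) (v, 0) :=
    fun m t v => (((hG.fderiv_right (m := ∞) (by simp)).comp (contDiff_prodMk_right t)).clm_apply
      contDiff_const).of_le (by exact_mod_cast le_top)
  -- Additivity of `∂^α` needs enough differentiability of each slice, supplied by `hsl` and `hsl'`.
  have hsub : mpderiv α (fun y => G (t, y) - G (t₀, y) - fderiv ℝ G (t₀, y) (t - t₀, 0)) =
      mpderiv α (fun y => G (t, y)) - mpderiv α (fun y => G (t₀, y)) -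
        mpderiv α fun y => fderiv ℝ G (t₀, y) (t - t₀, 0) := by
    rw [← mpderiv_sub (hsl _ t) (hsl _ t₀)]
    exact mpderiv_sub ((hsl _ t).sub (hsl _ t₀)) (hsl' _ t₀ _)
  rw [hsub, he, he, hdv]
  rfl

end Parameters

/-! ### Alternating forms and their coefficients in a basis. -/

section Alternating

variable {n p : ℕ} {E : Type*} [NormedAddCommGroup E] [NormedSpace ℝ E]

/-- The coefficients of an alternating form with respect to a family of vectors. -/
def altCoeff (e : Fin n → E) : (E [⋀^Fin p]→L[ℝ] ℝ) →L[ℝ] EuclideanSpace ℝ (Fin p ↪o Fin n) :=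
  (EuclideanSpace.equiv (Fin p ↪o Fin n) ℝ).symm.toContinuousLinearMap.comp
    (ContinuousLinearMap.pi fun s => ContinuousAlternatingMap.apply ℝ E ℝ fun a => e (s a))

lemma altCoeff_apply (e : Fin n → E) (ξ : E [⋀^Fin p]→L[ℝ] ℝ) :
    altCoeff e ξ = WithLp.toLp 2 fun s : Fin p ↪o Fin n => ξ fun a => e (s a) := rfl

/-- An alternating map is determined by injective index tuples; sorting such a tuple makes it
increasing and changes the value only by a sign. -/
lemma altCoeff_injective (b : Module.Basis (Fin n) ℝ E) :
    Function.Injective (altCoeff (p := p) b) := by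
  rw [injective_iff_map_eq_zero]
  intro ξ hξ
  have hmono : ∀ s : Fin p ↪o Fin n, ξ (fun a => b (s a)) = 0 := fun s =>
    congrFun (congrArg WithLp.ofLp hξ) s
  have h0 : ξ.toAlternatingMap = 0 := by
    refine Module.Basis.ext_alternating b fun v hv => ?_
    have hs : StrictMono (v ∘ Tuple.sort v) :=
      (Tuple.monotone_sort v).strictMono_of_injective (hv.comp (Equiv.injective _))
    have h1 := hmono (OrderEmbedding.ofStrictMono _ hs)
    have h2 := ξ.toAlternatingMap.map_perm (fun a => b (v a)) (Tuple.sort v)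
    have h3 : ξ.toAlternatingMap ((fun a => b (v a)) ∘ Tuple.sort v) = 0 := h1
    rw [h3] at h2
    rw [AlternatingMap.zero_apply]
    exact (smul_eq_zero_iff_eq _).1 h2.symm
  ext v
  exact congrArg (fun g => g v) h0

/-- An alternating form depends linearly and continuously on its coefficients in a basis. -/
lemma exists_leftInverse_altCoeff (b : Module.Basis (Fin n) ℝ E) :
    ∃ S : EuclideanSpace ℝ (Fin p ↪o Fin n) →L[ℝ] (E [⋀^Fin p]→L[ℝ] ℝ),
      ∀ ξ, S (altCoeff b ξ) = ξ := by
  -- The left inverse is purely algebraic; it is continuous because its source is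
  -- finite-dimensional.
  obtain ⟨g, hg⟩ := LinearMap.exists_leftInverse_of_injective
    (altCoeff (p := p) b).toLinearMap
    (LinearMap.ker_eq_bot_of_injective (altCoeff_injective b))
  exact ⟨LinearMap.toContinuousLinearMap g, fun ξ => LinearMap.congr_fun hg ξ⟩

end Alternating

/-! ### Smooth families of forms and their parameter derivatives. -/

section Forms

variable {n p : ℕ} {M : Type*} [TopologicalSpace M] [ChartedSpace (EuclideanSpace ℝ (Fin n)) M]

/-- The value of a form at a point, with the tangent space identified with the model space. -/
def Form.value (η : Form n p M) (x : M) : (EuclideanSpace ℝ (Fin n)) [⋀^Fin p]→L[ℝ] ℝ := η x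

/-- The coordinate vector fields with values in the model space. -/
def modelCoordVector (φ : OpenPartialHomeomorph M (EuclideanSpace ℝ (Fin n)))
    (y : EuclideanSpace ℝ (Fin n)) (i : Fin n) : EuclideanSpace ℝ (Fin n) := coordVector φ y i

lemma coeff_eq_altCoeff (φ : OpenPartialHomeomorph M (EuclideanSpace ℝ (Fin n)))
    (η : Form n p M) (y : EuclideanSpace ℝ (Fin n)) :
    coeff φ η y = altCoeff (modelCoordVector φ y) (η.value (φ.symm y)) := rfl

variable {T : Type*} [NormedAddCommGroup T] [NormedSpace ℝ T]

/-- The derivative of a family of forms in a direction of the parameter space. -/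
def familyDeriv (η : T → Form n p M) (v t : T) : Form n p M :=
  fun x => fderiv ℝ (fun s => (η s).value x) t v

lemma familyDeriv_add (η : T → Form n p M) (v w t : T) :
    familyDeriv η (v + w) t = familyDeriv η v t + familyDeriv η w t := by
  funext x
  exact map_add (fderiv ℝ (fun s => (η s).value x) t) v w

lemma familyDeriv_smul (η : T → Form n p M) (c : ℝ) (v t : T) :
    familyDeriv η (c • v) t = c • familyDeriv η v t := by
  funext x
  exact map_smul (fderiv ℝ (fun s => (η s).value x) t) c v

lemma exists_basis_modelCoordVector [IsManifold (𝓡 n) ∞ M]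
    {φ : OpenPartialHomeomorph M (EuclideanSpace ℝ (Fin n))}
    (hφ : φ ∈ IsManifold.maximalAtlas (𝓡 n) ∞ M) {y : EuclideanSpace ℝ (Fin n)}
    (hy : y ∈ φ.target) :
    ∃ b : Module.Basis (Fin n) ℝ (EuclideanSpace ℝ (Fin n)), ⇑b = modelCoordVector φ y := by
  let e : EuclideanSpace ℝ (Fin n) ≃ₗ[ℝ] EuclideanSpace ℝ (Fin n) :=
    ((mdifferentiable_of_mem hφ).symm.mfderiv (x := y) hy).toLinearEquiv
  refine ⟨(EuclideanSpace.basisFun (Fin n) ℝ).toBasis.map e, ?_⟩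
  ext1 i
  rw [Module.Basis.map_apply, OrthonormalBasis.coe_toBasis, EuclideanSpace.basisFun_apply]
  rfl

variable {l : ℕ} {η : EuclideanSpace ℝ (Fin l) → Form n p M}

lemma exists_mem_maximalAtlas [IsManifold (𝓡 n) ∞ M] (x : M) :
    ∃ φ ∈ IsManifold.maximalAtlas (𝓡 n) ∞ M, x ∈ φ.source :=
  ⟨chartAt _ x, IsManifold.chart_mem_maximalAtlas x, mem_chart_source _ x⟩

lemma IsSmoothFamily.contDiffAt (hη : IsSmoothFamily η)
    {φ : OpenPartialHomeomorph M (EuclideanSpace ℝ (Fin n))}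
    (hφ : φ ∈ IsManifold.maximalAtlas (𝓡 n) ∞ M) (t : EuclideanSpace ℝ (Fin l))
    {y : EuclideanSpace ℝ (Fin n)} (hy : y ∈ φ.target) :
    ContDiffAt ℝ ∞ (fun q : EuclideanSpace ℝ (Fin l) × EuclideanSpace ℝ (Fin n) =>
      coeff φ (η q.1) q.2) (t, y) :=
  (hη φ hφ).contDiffAt ((isOpen_univ.prod φ.open_target).mem_nhds ⟨trivial, hy⟩)

lemma IsSmoothFamily.isCk (hη : IsSmoothFamily η) (k : ℕ) (t : EuclideanSpace ℝ (Fin l)) :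
    IsCk k (η t) := fun _ hφ y hy =>
  (((hη.contDiffAt hφ t hy).comp y (contDiff_prodMk_right t).contDiffAt).of_le
    (by exact_mod_cast le_top)).contDiffWithinAt

/-- At a fixed point the value is a fixed continuous linear function of the coefficients in one
chart. -/
lemma IsSmoothFamily.contDiff_value [IsManifold (𝓡 n) ∞ M] (hη : IsSmoothFamily η) (x : M) :
    ContDiff ℝ ∞ fun t => (η t).value x := by
  obtain ⟨φ, hφ, hx⟩ := exists_mem_maximalAtlas (n := n) x
  have hy := φ.map_source hx
  obtain ⟨b, hb⟩ := exists_basis_modelCoordVector hφ hy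
  obtain ⟨S, hS⟩ := exists_leftInverse_altCoeff (p := p) b
  have h : (fun t => (η t).value x) = fun t => S (coeff φ (η t) (φ x)) := by
    ext1 t
    rw [coeff_eq_altCoeff, ← hb, hS, φ.left_inv hx]
  rw [h, contDiff_iff_contDiffAt]
  exact fun t => S.contDiff.contDiffAt.comp t (ContDiffAt.comp t
    (g := fun q : EuclideanSpace ℝ (Fin l) × EuclideanSpace ℝ (Fin n) => coeff φ (η q.1) q.2)
    (hη.contDiffAt hφ t hy) (contDiff_prodMk_left (φ x)).contDiffAt)

/-- Linear expressions in the value of a family at a point commute with derivatives in the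
parameter. -/
lemma IsSmoothFamily.fderiv_apply_inl [IsManifold (𝓡 n) ∞ M] (hη : IsSmoothFamily η)
    {V : Type*} [NormedAddCommGroup V] [NormedSpace ℝ V]
    {F : EuclideanSpace ℝ (Fin l) × EuclideanSpace ℝ (Fin n) → V}
    {t : EuclideanSpace ℝ (Fin l)} {y : EuclideanSpace ℝ (Fin n)} (hF : DifferentiableAt ℝ F (t, y))
    (A : ((EuclideanSpace ℝ (Fin n)) [⋀^Fin p]→L[ℝ] ℝ) →L[ℝ] V) (x : M)
    (hA : ∀ s, F (s, y) = A ((η s).value x)) (v : EuclideanSpace ℝ (Fin l)) :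
    fderiv ℝ F (t, y) (v, 0) = A ((familyDeriv η v t).value x) := by
  have h1 := hasFDerivAt_slice_left hF
  have h2 := A.hasFDerivAt.comp t
    ((hη.contDiff_value x).differentiable (by simp) t).hasFDerivAt
  have h3 : (fun s => F (s, y)) = A ∘ fun s => (η s).value x := funext hA
  rw [h3] at h1
  simpa using! congrArg (fun B => B v) (h1.unique h2)

/-- The coefficients of the derived family are the derivatives of the coefficients in the direction
`(v, 0)`. This closure property drives the induction in `IsSmoothFamily.contDiff_mk`. -/
lemma IsSmoothFamily.deriv [IsManifold (𝓡 n) ∞ M] (hη : IsSmoothFamily η)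
    (v : EuclideanSpace ℝ (Fin l)) : IsSmoothFamily (familyDeriv η v) := by
  intro φ hφ
  have h := ((hη φ hφ).fderiv_of_isOpen (isOpen_univ.prod φ.open_target) (m := ∞)
    (by simp)).clm_apply (contDiffOn_const (c := (v, (0 : EuclideanSpace ℝ (Fin n)))))
  refine h.congr fun q hq => ?_
  exact (hη.fderiv_apply_inl ((hη.contDiffAt hφ q.1 hq.2).differentiableAt (by simp))
    (altCoeff (modelCoordVector φ q.2)) (φ.symm q.2) (fun _ => rfl) v).symm

namespace ChartPartition

variable {ι : Type*} (D : ChartPartition n M ι)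

/-- Linear dependence on the value at a single point is what lets parameter derivatives pass through
local coefficients. -/
lemma exists_localCoeff_eq (i : ι) (y : EuclideanSpace ℝ (Fin n)) :
    ∃ A : ((EuclideanSpace ℝ (Fin n)) [⋀^Fin p]→L[ℝ] ℝ) →L[ℝ] EuclideanSpace ℝ (Fin p ↪o Fin n),
      ∀ η : Form n p M, D.localCoeff i η y = A (η.value ((D.chart i).symm y)) := by
  by_cases hy : y ∈ (D.chart i).target
  · exact ⟨D.pou i ((D.chart i).symm y) • altCoeff (modelCoordVector (D.chart i) y),
      fun η => D.localCoeff_apply_of_mem i η hy⟩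
  · exact ⟨0, fun η => by simp [localCoeff, hy]⟩

lemma localCoeff_sub (i : ι) (η θ : Form n p M) :
    D.localCoeff i (η - θ) = D.localCoeff i η - D.localCoeff i θ := by
  ext1 y
  obtain ⟨A, hA⟩ := D.exists_localCoeff_eq (p := p) i y
  rw [Pi.sub_apply, hA, hA, hA]
  exact map_sub A _ _

lemma contDiffOn_pou [IsManifold (𝓡 n) ∞ M] (i : ι) :
    ContDiffOn ℝ ∞ (fun y => D.pou i ((D.chart i).symm y)) (D.chart i).target := by
  have h : ContMDiffOn (𝓡 n) 𝓘(ℝ, ℝ) ∞ (fun y => D.pou i ((D.chart i).symm y))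
      (D.chart i).target :=
    (D.pou i).contMDiff.comp_contMDiffOn
      (contMDiffOn_symm_of_mem_maximalAtlas (D.chart_mem i))
  exact h.contDiffOn

variable [CompactSpace M]

/-- Over the chart target this is a product of smooth functions. At any other point the extension by
zero vanishes nearby, since the image of the support is compact, hence closed. -/
lemma contDiff_localCoeff_family [IsManifold (𝓡 n) ∞ M] (hη : IsSmoothFamily η) (i : ι) :
    ContDiff ℝ ∞ fun q : EuclideanSpace ℝ (Fin l) × EuclideanSpace ℝ (Fin n) =>
      D.localCoeff i (η q.1) q.2 := by
  rw [contDiff_iff_contDiffAt]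
  rintro ⟨t, y⟩
  by_cases hy : y ∈ (D.chart i).target
  · have hn : (D.chart i).target ∈ nhds y := (D.chart i).open_target.mem_nhds hy
    have h1 := ((D.contDiffOn_pou i).contDiffAt hn).comp (t, y)
      (contDiff_snd (E := EuclideanSpace ℝ (Fin l))).contDiffAt
    refine (h1.smul (hη.contDiffAt (D.chart_mem i) t hy)).congr_of_eventuallyEq ?_
    filter_upwards [continuous_snd.continuousAt.preimage_mem_nhds hn] with q hq
    exact D.localCoeff_apply_of_mem i _ hq
  · have hn : (D.chart i '' tsupport (D.pou i))ᶜ ∈ nhds y := by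
      refine (D.isCompact_image i).isClosed.isOpen_compl.mem_nhds ?_
      rintro ⟨x, hx, rfl⟩
      exact hy ((D.chart i).map_source (D.subordinate i hx))
    refine (contDiffAt_const (c := (0 : EuclideanSpace ℝ (Fin p ↪o Fin n)))).congr_of_eventuallyEq ?_
    filter_upwards [continuous_snd.continuousAt.preimage_mem_nhds hn] with q hq
    exact D.localCoeff_eq_zero i _ hq

lemma fderiv_localCoeff_family [IsManifold (𝓡 n) ∞ M] (hη : IsSmoothFamily η) (i : ι)
    (t v : EuclideanSpace ℝ (Fin l)) (y : EuclideanSpace ℝ (Fin n)) :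
    fderiv ℝ (fun q : EuclideanSpace ℝ (Fin l) × EuclideanSpace ℝ (Fin n) =>
      D.localCoeff i (η q.1) q.2) (t, y) (v, 0) = D.localCoeff i (familyDeriv η v t) y := by
  obtain ⟨A, hA⟩ := D.exists_localCoeff_eq (p := p) i y
  rw [hA]
  exact hη.fderiv_apply_inl ((D.contDiff_localCoeff_family hη i).differentiable (by simp) _) A _
    (fun s => hA (η s)) v

end ChartPartition

/-! ### Change of coordinates -/

/-- If the coefficients of a family are smooth near a point in one chart then they are smooth near
this point in every chart. -/
lemma contDiffAt_coeff_of_contDiffAt_coeff [IsManifold (𝓡 n) ∞ M]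
    {φ ψ : OpenPartialHomeomorph M (EuclideanSpace ℝ (Fin n))}
    (hφ : φ ∈ IsManifold.maximalAtlas (𝓡 n) ∞ M) (hψ : ψ ∈ IsManifold.maximalAtlas (𝓡 n) ∞ M)
    (t : EuclideanSpace ℝ (Fin l)) {y : EuclideanSpace ℝ (Fin n)} (hy : y ∈ φ.target)
    (hx : φ.symm y ∈ ψ.source)
    (h : ContDiffAt ℝ ∞ (fun q : EuclideanSpace ℝ (Fin l) × EuclideanSpace ℝ (Fin n) =>
      coeff ψ (η q.1) q.2) (t, ψ (φ.symm y))) :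
    ContDiffAt ℝ ∞ (fun q : EuclideanSpace ℝ (Fin l) × EuclideanSpace ℝ (Fin n) =>
      coeff φ (η q.1) q.2) (t, y) := by
  set τ : EuclideanSpace ℝ (Fin n) → EuclideanSpace ℝ (Fin n) := fun z => ψ (φ.symm z) with hτ
  set U := φ.target ∩ φ.symm ⁻¹' ψ.source with hU
  have hUo : IsOpen U := φ.isOpen_inter_preimage_symm ψ.open_source
  have hτU : ContDiffOn ℝ ∞ τ U := by
    have : ContMDiffOn (𝓡 n) (𝓡 n) ∞ τ U :=
      (contMDiffOn_of_mem_maximalAtlas hψ).comp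
        ((contMDiffOn_symm_of_mem_maximalAtlas hφ).mono Set.inter_subset_left)
        Set.inter_subset_right
    exact this.contDiffOn
  have hyU : U ∈ nhds y := hUo.mem_nhds ⟨hy, hx⟩
  -- `S` rebuilds an alternating form on the model space from its standard coefficients; applied to
  -- the `ψ`-coefficients it gives the pullback by `ψ.symm`.
  obtain ⟨S, hS⟩ := exists_leftInverse_altCoeff (p := p)
    (EuclideanSpace.basisFun (Fin n) ℝ).toBasis
  have key : ∀ z ∈ U, ∀ θ : Form n p M, coeff φ θ z = WithLp.toLp 2 fun s =>
      S (coeff ψ θ (τ z)) fun a => fderiv ℝ τ z (EuclideanSpace.single (s a) 1) := by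
    intro z hz θ
    have hτz : τ z ∈ ψ.target := ψ.map_source hz.2
    have hback : ψ.symm (τ z) = φ.symm z := ψ.left_inv hz.2
    have hzn : U ∈ nhds z := hUo.mem_nhds hz
    have hdτ : DifferentiableAt ℝ τ z :=
      (hτU.contDiffAt hzn).differentiableAt (by simp)
    have hdψ : MDifferentiableAt (𝓡 n) (𝓡 n) ψ.symm (τ z) :=
      (mdifferentiable_of_mem hψ).mdifferentiableAt_symm hτz
    let B : EuclideanSpace ℝ (Fin n) →L[ℝ] EuclideanSpace ℝ (Fin n) :=
      mfderiv (𝓡 n) (𝓡 n) ψ.symm (τ z)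
    -- Chain rule for `φ.symm = ψ.symm ∘ τ`, which holds near `z`.
    have hvec : ∀ j, modelCoordVector φ z j =
        B (fderiv ℝ τ z (EuclideanSpace.single j 1)) := by
      intro j
      have hEq : φ.symm =ᶠ[nhds z] ψ.symm ∘ τ := by
        filter_upwards [hzn] with w hw using (ψ.left_inv hw.2).symm
      have h1 := hEq.mfderiv_eq (I := 𝓡 n) (I' := 𝓡 n)
      have h2 := mfderiv_comp z hdψ hdτ.mdifferentiableAt
      rw [mfderiv_eq_fderiv] at h2
      exact congrArg (fun A : EuclideanSpace ℝ (Fin n) →L[ℝ] EuclideanSpace ℝ (Fin n) =>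
        A (EuclideanSpace.single j 1)) (h1.trans h2)
    have hSB : S (coeff ψ θ (τ z)) =
        (θ.value (ψ.symm (τ z))).compContinuousLinearMap B := by
      rw [← hS ((θ.value (ψ.symm (τ z))).compContinuousLinearMap B), coeff_eq_altCoeff]
      congr 1
      rw [altCoeff_apply, altCoeff_apply]
      congr 1
      ext1 s
      simp only [OrthonormalBasis.coe_toBasis, EuclideanSpace.basisFun_apply]
      rfl
    rw [hSB, hback, coeff_eq_altCoeff, altCoeff_apply]
    congr 1
    ext1 s
    simp only [hvec]
    rfl
  have hmain : ContDiffAt ℝ ∞ (fun q : EuclideanSpace ℝ (Fin l) × EuclideanSpace ℝ (Fin n) =>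
      (WithLp.toLp 2 fun s : Fin p ↪o Fin n => S (coeff ψ (η q.1) (τ q.2)) fun a =>
        fderiv ℝ τ q.2 (EuclideanSpace.single (s a) 1) :
        EuclideanSpace ℝ (Fin p ↪o Fin n))) (t, y) := by
    rw [contDiffAt_euclidean]
    intro s
    have hτ2 : ContDiffAt ℝ ∞ (fun q : EuclideanSpace ℝ (Fin l) × EuclideanSpace ℝ (Fin n) =>
        τ q.2) (t, y) :=
      ContDiffAt.comp (t, y) (g := τ) (hτU.contDiffAt hyU) contDiffAt_snd
    have hdτ2 : ContDiffAt ℝ ∞ (fun q : EuclideanSpace ℝ (Fin l) × EuclideanSpace ℝ (Fin n) =>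
        fderiv ℝ τ q.2) (t, y) :=
      ((hτU.contDiffAt hyU).fderiv_right (m := ∞) (by simp)).comp (t, y) contDiffAt_snd
    have hc : ContDiffAt ℝ ∞ (fun q : EuclideanSpace ℝ (Fin l) × EuclideanSpace ℝ (Fin n) =>
        coeff ψ (η q.1) (τ q.2)) (t, y) :=
      ContDiffAt.comp (t, y) (g := fun q : EuclideanSpace ℝ (Fin l) × EuclideanSpace ℝ (Fin n) =>
        coeff ψ (η q.1) q.2) h (contDiffAt_fst.prodMk hτ2)
    -- Evaluation is linear in the coefficients and multilinear in the vectors, hence jointly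
    -- analytic.
    let f := (ContinuousAlternatingMap.toContinuousMultilinearMapCLM ℝ
      (E := EuclideanSpace ℝ (Fin n)) (F := ℝ) (ι := Fin p)).comp S
    have hf := f.analyticOnNhd_uncurry_of_multilinear (s := Set.univ)
    have hf' := hf.contDiff (n := ∞)
    refine ContDiffAt.comp (t, y) (g := fun r : EuclideanSpace ℝ (Fin p ↪o Fin n) ×
      (Fin p → EuclideanSpace ℝ (Fin n)) => f r.1 r.2) hf'.contDiffAt (hc.prodMk ?_)
    rw [contDiffAt_pi]
    exact fun a => hdτ2.clm_apply contDiffAt_const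
  refine hmain.congr_of_eventuallyEq ?_
  filter_upwards [continuous_snd.continuousAt.preimage_mem_nhds hyU] with q hq
  exact key q.2 hq (η q.1)

end Forms

/-! ### Evaluation functionals on `C^k`, and the two implications. -/

section Evaluation

variable {n p : ℕ} {M : Type*} [TopologicalSpace M] [ChartedSpace (EuclideanSpace ℝ (Fin n)) M]
  [CompactSpace M] [IsManifold (𝓡 n) ∞ M] {ι : Type*} [Fintype ι]

namespace CkForms

variable (D : ChartPartition n M ι) (k : ℕ)

lemma norm_mpderiv_localCoeff_le (i : ι) {α : Fin n → ℕ} (hα : ∑ j, α j ≤ k)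
    (y : EuclideanSpace ℝ (Fin n)) (θ : CkForms p D k) :
    ‖mpderiv α (D.localCoeff i θ.form) y‖ ≤ ‖θ‖ :=
  (norm_mpderiv_le_ckNorm hα (D.contDiff_localCoeff i θ.isCk)
    (D.hasCompactSupport_localCoeff i θ.form) y).trans
    (Finset.single_le_sum (f := fun i => ckNorm k (D.localCoeff i θ.form))
      (fun _ _ => ckNorm_nonneg k _) (Finset.mem_univ i))

/-- The evaluation at a point of a partial derivative of a local coefficient vector. -/
def evalCLM (i : ι) {α : Fin n → ℕ} (hα : ∑ j, α j ≤ k) (y : EuclideanSpace ℝ (Fin n)) :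
    CkForms p D k →L[ℝ] EuclideanSpace ℝ (Fin p ↪o Fin n) :=
  LinearMap.mkContinuous
    { toFun := fun θ => mpderiv α (D.localCoeff i θ.form) y
      map_add' := fun θ ξ => by
        have hle : ((∑ j, α j : ℕ) : ℕ∞) ≤ (k : ℕ∞) := by exact_mod_cast hα
        have h := mpderiv_add ((D.contDiff_localCoeff i θ.isCk).of_le (WithTop.coe_le_coe.2 hle))
          ((D.contDiff_localCoeff i ξ.isCk).of_le (WithTop.coe_le_coe.2 hle))
        rw [← D.localCoeff_add] at h
        exact congrFun h y
      map_smul' := fun c θ => by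
        have hle : ((∑ j, α j : ℕ) : ℕ∞) ≤ (k : ℕ∞) := by exact_mod_cast hα
        have h := mpderiv_smul c
          ((D.contDiff_localCoeff i θ.isCk).of_le (WithTop.coe_le_coe.2 hle))
        rw [← D.localCoeff_smul] at h
        exact congrFun h y } 1
    fun θ => by
      rw [one_mul]
      exact norm_mpderiv_localCoeff_le D k i hα y θ

lemma evalCLM_apply (i : ι) {α : Fin n → ℕ} (hα : ∑ j, α j ≤ k) (y : EuclideanSpace ℝ (Fin n))
    (θ : CkForms p D k) : evalCLM D k i hα y θ = mpderiv α (D.localCoeff i θ.form) y := rfl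

variable {l : ℕ} {D k}

lemma continuous_mpderiv_localCoeff (i : ι) {α : Fin n → ℕ} (hα : ∑ j, α j ≤ k)
    {ζ : EuclideanSpace ℝ (Fin l) → CkForms p D k} (hζ : Continuous ζ) :
    Continuous fun q : EuclideanSpace ℝ (Fin l) × EuclideanSpace ℝ (Fin n) =>
      mpderiv α (D.localCoeff i (ζ q.1).form) q.2 := by
  rw [continuous_iff_continuousAt]
  rintro ⟨t₀, y₀⟩
  have h1 : Continuous (mpderiv α (D.localCoeff i (ζ t₀).form)) :=
    (contDiff_mpderiv α 0 ((D.contDiff_localCoeff i (ζ t₀).isCk).of_le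
      (WithTop.coe_le_coe.2 (by rw [zero_add]; exact_mod_cast hα)))).continuous
  have h2 : Filter.Tendsto (fun q : EuclideanSpace ℝ (Fin l) × EuclideanSpace ℝ (Fin n) =>
      mpderiv α (D.localCoeff i (ζ q.1).form) q.2 - mpderiv α (D.localCoeff i (ζ t₀).form) q.2)
      (nhds (t₀, y₀)) (nhds 0) := by
    have h3 : Filter.Tendsto (fun q : EuclideanSpace ℝ (Fin l) × EuclideanSpace ℝ (Fin n) =>
        ‖ζ q.1 - ζ t₀‖) (nhds (t₀, y₀)) (nhds 0) := by
      have : Continuous fun q : EuclideanSpace ℝ (Fin l) × EuclideanSpace ℝ (Fin n) =>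
        ‖ζ q.1 - ζ t₀‖ := by fun_prop
      simpa using this.tendsto (t₀, y₀)
    refine squeeze_zero_norm (fun q => ?_) h3
    rw [← evalCLM_apply D k i hα, ← evalCLM_apply D k i hα, ← map_sub, evalCLM_apply]
    exact norm_mpderiv_localCoeff_le D k i hα _ _
  -- The difference from `ζ t₀` is small uniformly in `y` by the norm bound; the remaining term is
  -- continuous in `y` alone.
  have h4 := h2.add ((h1.comp continuous_snd).tendsto (t₀, y₀))
  simpa [ContinuousAt] using h4

/-- The partial derivatives of the local coefficients of a smooth curve of forms of class `C^k` are
jointly of class `C^m`, if `m` is at most `k` minus the order. -/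
lemma contDiff_mpderiv_localCoeff (i : ι) (m : ℕ) {α : Fin n → ℕ} (hα : ∑ j, α j + m ≤ k)
    {ζ : EuclideanSpace ℝ (Fin l) → CkForms p D k} (hζ : ContDiff ℝ ∞ ζ) :
    ContDiff ℝ m fun q : EuclideanSpace ℝ (Fin l) × EuclideanSpace ℝ (Fin n) =>
      mpderiv α (D.localCoeff i (ζ q.1).form) q.2 := by
  induction m generalizing α ζ with
  | zero =>
    exact contDiff_zero.2 (continuous_mpderiv_localCoeff i (by simpa using hα) hζ.continuous)
  | succ m ih =>
    have hα' : ∑ j, α j ≤ k := by omega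
    have hα1 : ((∑ j, α j + 1 : ℕ) : ℕ∞) ≤ (k : ℕ∞) := by norm_cast; omega
    have hsum : ∀ j : Fin n, ∑ r, (α + Pi.single j 1 : Fin n → ℕ) r = ∑ r, α r + 1 := by
      intro j
      simp [Finset.sum_add_distrib]
    have hsl : ∀ t, Differentiable ℝ (mpderiv α (D.localCoeff i (ζ t).form)) := fun t =>
      (contDiff_mpderiv α 1 ((D.contDiff_localCoeff i (ζ t).isCk).of_le
        (WithTop.coe_le_coe.2 (by rwa [add_comm])))).differentiable (by simp)
    let f₁ : EuclideanSpace ℝ (Fin l) → EuclideanSpace ℝ (Fin n) →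
        EuclideanSpace ℝ (Fin l) →L[ℝ] EuclideanSpace ℝ (Fin p ↪o Fin n) :=
      fun t y => (evalCLM D k i hα' y).comp (fderiv ℝ ζ t)
    let f₂ : EuclideanSpace ℝ (Fin l) → EuclideanSpace ℝ (Fin n) →
        EuclideanSpace ℝ (Fin n) →L[ℝ] EuclideanSpace ℝ (Fin p ↪o Fin n) :=
      fun t y => fderiv ℝ (mpderiv α (D.localCoeff i (ζ t).form)) y
    -- Evaluated at `v`, this is the same expression for the curve `∂_v ζ`, with `α` unchanged.
    have hf₁ : ContDiff ℝ m (Function.uncurry f₁) := by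
      rw [contDiff_clm_apply_iff]
      intro v
      exact ih (ζ := fun t => fderiv ℝ ζ t v) (by omega)
        ((hζ.fderiv_right (m := ∞) (by simp)).clm_apply contDiff_const)
    -- Here `|α|` rises by one while the smoothness drops from `m + 1` to `m`, so the sum still does
    -- not exceed `k`.
    have hf₂ : ContDiff ℝ m (Function.uncurry f₂) := by
      rw [contDiff_clm_apply_iff]
      intro w
      have hw : ∀ q : EuclideanSpace ℝ (Fin l) × EuclideanSpace ℝ (Fin n),
          Function.uncurry f₂ q w = ∑ j, w j •
            mpderiv (α + Pi.single j 1) (D.localCoeff i (ζ q.1).form) q.2 := by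
        intro q
        conv_lhs => rw [← (EuclideanSpace.basisFun (Fin n) ℝ).sum_repr w]
        rw [map_sum]
        refine Finset.sum_congr rfl fun j _ => ?_
        rw [map_smul, ← pderiv_mpderiv α j ((D.contDiff_localCoeff i (ζ q.1).isCk).of_le
          (WithTop.coe_le_coe.2 hα1))]
        simp [Function.uncurry, f₂, pderiv]
      simp only [hw]
      exact ContDiff.sum fun j _ => (ih (by rw [hsum]; omega) hζ).const_smul (w j)
    have hder : ∀ q, HasFDerivAt (fun q : EuclideanSpace ℝ (Fin l) × EuclideanSpace ℝ (Fin n) =>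
        mpderiv α (D.localCoeff i (ζ q.1).form) q.2)
        ((Function.uncurry f₁ q).coprod (Function.uncurry f₂ q)) q := by
      intro q
      -- Continuous partial derivatives in `t` and `y` give joint differentiability.
      refine (hasStrictFDerivAt_uncurry_coprod
        (f := fun t y => mpderiv α (D.localCoeff i (ζ t).form) y) (f₁ := f₁) (f₂ := f₂)
        (.of_forall fun v => ?_) (.of_forall fun v => (hsl v.1 v.2).hasFDerivAt)
        hf₁.continuous.continuousAt hf₂.continuous.continuousAt).hasFDerivAt
      exact (evalCLM D k i hα' v.2).hasFDerivAt.comp v.1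
        (hζ.differentiable (by simp) v.1).hasFDerivAt
    push_cast
    rw [contDiff_succ_iff_hasFDerivAt]
    refine ⟨_, ?_, hder⟩
    have : (fun q => (Function.uncurry f₁ q).coprod (Function.uncurry f₂ q)) = fun q =>
        (Function.uncurry f₁ q).comp (.fst ℝ _ _) + (Function.uncurry f₂ q).comp (.snd ℝ _ _) := by
      ext q v <;> simp
    rw [this]
    exact (hf₁.clm_comp contDiff_const).add (hf₂.clm_comp contDiff_const)

end CkForms

variable {D : ChartPartition n M ι} {l : ℕ} {η : EuclideanSpace ℝ (Fin l) → Form n p M}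

/-- A family that is smooth as a map to each space `C^k` is a smooth family. -/
lemma isSmoothFamily_of_contDiff_mk
    (h : ∀ k : ℕ, ∃ hη : ∀ t, IsCk k (η t),
      ContDiff ℝ ∞ fun t => (CkForms.mk (η t) (hη t) : CkForms p D k)) : IsSmoothFamily η := by
  have hloc : ∀ i, ContDiff ℝ ∞ fun q : EuclideanSpace ℝ (Fin l) × EuclideanSpace ℝ (Fin n) =>
      D.localCoeff i (η q.1) q.2 := by
    intro i
    rw [contDiff_infty]
    intro m
    obtain ⟨hη, hm⟩ := h m
    have := CkForms.contDiff_mpderiv_localCoeff i m (α := 0) (by simp) hm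
    simp only [mpderiv_zero] at this
    exact this
  rintro φ hφ ⟨t, y⟩ ⟨-, hy⟩
  obtain ⟨i, hi⟩ : ∃ i, D.pou i (φ.symm y) ≠ 0 := by
    by_contra! hx
    have := D.pou.sum_eq_one (Set.mem_univ (φ.symm y))
    simp [hx] at this
  have hx : φ.symm y ∈ (D.chart i).source := D.subordinate i (subset_tsupport _ hi)
  refine (contDiffAt_coeff_of_contDiffAt_coeff hφ (D.chart_mem i) t hy hx ?_).contDiffWithinAt
  set z := D.chart i (φ.symm y) with hz
  have hzt : z ∈ (D.chart i).target := (D.chart i).map_source hx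
  have hzn : (D.chart i).target ∈ nhds z := (D.chart i).open_target.mem_nhds hzt
  have hpou := (D.contDiffOn_pou i).contDiffAt hzn
  have hz0 : D.pou i ((D.chart i).symm z) ≠ 0 := by rwa [hz, (D.chart i).left_inv hx]
  -- Near `z` the weight `λ_i` is nonzero, so it can be divided out of the local coefficients.
  have hinv : ContDiffAt ℝ ∞ (fun q : EuclideanSpace ℝ (Fin l) × EuclideanSpace ℝ (Fin n) =>
      (D.pou i ((D.chart i).symm q.2))⁻¹) (t, z) :=
    ContDiffAt.inv (ContDiffAt.comp (t, z) (f := Prod.snd) hpou contDiffAt_snd) hz0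
  refine (hinv.smul (hloc i).contDiffAt).congr_of_eventuallyEq ?_
  filter_upwards [continuous_snd.continuousAt.preimage_mem_nhds hzn,
    continuous_snd.continuousAt.preimage_mem_nhds (hpou.continuousAt.eventually_ne hz0)]
    with q hq hq0
  rw [Pi.smul_apply', D.localCoeff_apply_of_mem i _ hq, inv_smul_smul₀ hq0]

/-- The derivative of a smooth family as a map to `C^k`. -/
lemma IsSmoothFamily.hasFDerivAt_mk (hη : IsSmoothFamily η) (k : ℕ)
    (L : EuclideanSpace ℝ (Fin l) →L[ℝ] CkForms p D k) (t₀ : EuclideanSpace ℝ (Fin l))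
    (hL : ∀ v, L v = CkForms.mk (familyDeriv η v t₀) ((hη.deriv v).isCk k t₀)) :
    HasFDerivAt (fun t => (CkForms.mk (η t) (hη.isCk k t) : CkForms p D k)) L t₀ := by
  rw [hasFDerivAt_iff_isLittleO, ← Asymptotics.isLittleO_norm_left]
  simp only [CkForms.norm_def]
  refine Asymptotics.IsLittleO.fun_sum fun i _ => ?_
  refine (isLittleO_ckNorm_taylor (D.contDiff_localCoeff_family hη i) (D.isCompact_image i)
    (fun t y hy => D.localCoeff_eq_zero i (η t) hy) k t₀).congr_left fun t => ?_
  congr 1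
  ext1 y
  rw [D.fderiv_localCoeff_family hη, hL]
  change _ = D.localCoeff i (η t - η t₀ - familyDeriv η (t - t₀) t₀) y
  rw [D.localCoeff_sub, D.localCoeff_sub]
  rfl

/-- The derivative of a smooth family as a linear map to `C^k`. -/
def IsSmoothFamily.derivCLM (hη : IsSmoothFamily η) (D : ChartPartition n M ι) (k : ℕ)
    (t : EuclideanSpace ℝ (Fin l)) : EuclideanSpace ℝ (Fin l) →L[ℝ] CkForms p D k :=
  -- Continuity is automatic because the parameter space is finite-dimensional.
  LinearMap.toContinuousLinearMap
    { toFun := fun v => CkForms.mk (familyDeriv η v t) ((hη.deriv v).isCk k t)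
      map_add' := fun v w => Subtype.ext (familyDeriv_add η v w t)
      map_smul' := fun c v => Subtype.ext (familyDeriv_smul η c v t) }

/-- A smooth family is smooth as a map to `C^k`. -/
lemma IsSmoothFamily.contDiff_mk (hη : IsSmoothFamily η) (D : ChartPartition n M ι) (k : ℕ) :
    ContDiff ℝ ∞ fun t => (CkForms.mk (η t) (hη.isCk k t) : CkForms p D k) := by
  rw [contDiff_infty]
  intro m
  -- The family must vary: the inductive hypothesis is applied to `familyDeriv η v`.
  induction m generalizing η with
  | zero =>
    exact contDiff_zero.2 (continuous_iff_continuousAt.2 fun t =>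
      (hη.hasFDerivAt_mk k (hη.derivCLM D k t) t fun _ => rfl).continuousAt)
  | succ m ih =>
    push_cast
    rw [contDiff_succ_iff_hasFDerivAt]
    refine ⟨hη.derivCLM D k, ?_, fun t => hη.hasFDerivAt_mk k _ t fun _ => rfl⟩
    rw [contDiff_clm_apply_iff]
    exact fun v => ih (hη.deriv v)

end Evaluation

end FormFamily

end

theorem theorem2 (n p l : ℕ) {M : Type*} [TopologicalSpace M] [T2Space M] [CompactSpace M]
    [ChartedSpace (EuclideanSpace ℝ (Fin n)) M] [IsManifold (𝓡 n) ∞ M]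
    {ι : Type*} [Fintype ι] (D : FormFamily.ChartPartition n M ι)
    (η : EuclideanSpace ℝ (Fin l) → FormFamily.Form n p M) :
    FormFamily.IsSmoothFamily η ↔
      ∀ k : ℕ, ∃ hη : ∀ t, FormFamily.IsCk k (η t),
        ContDiff ℝ ∞ (fun t => (FormFamily.CkForms.mk (η t) (hη t) : FormFamily.CkForms p D k)) :=
  ⟨fun h k => ⟨h.isCk k, h.contDiff_mk D k⟩, FormFamily.isSmoothFamily_of_contDiff_mk⟩
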